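/- **Definitions.** *Frames.* An element $k$ of a complete lattice $L$ is compact if $k\le\bigvee S$ implies $k\le\bigvee T$ for some finite $T\subseteq S$. A *generalized Stone frame* is a frame $L$ that is algebraic (every element is a join of compact elements) and zero-dimensional (every element is a join of complemented elements). Let $\mathsf{GStoneFrm_J}$ be the category of generalized Stone frames and maps preserving arbitrary joins and compact elements. $\mathsf{GStoneFrm_S}$ is the wide subcategory of those $\alpha$ with $\alpha(\bigwedge S)=\bigwedge\alpha[S]$ whenever $S$ is a nonempty finite set of compact elements with $\bigwedge S$ compact. $\mathsf{GStoneFrm}$ is the wide subcategory of those $\alpha$ that preserve all finite meets (frame homomorphisms preserving compact elements). *Generalized Boolean algebras.* A meet-semilattice $M$ with top $1$ is distributive if $a\wedge b\le c$ implies $c=a'\wedge b'$ for some $a'\ge a$, $b'\ge b$. A *generalized Boolean algebra* is a distributive meet-semilattice with top that is a lattice and in which every interval $[a,1]$ is a Boolean algebra (it need not have a bottom). Let $\mathsf{GBA_M}$ be the category of generalized Boolean algebras and maps preserving finite meets (including $1$). $\mathsf{GBA}$ is the wide subcategory of those maps that preserve joins of nonempty finite sets (lattice homomorphisms preserving $1$).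 $\mathsf{GBA_P}$ is the wide subcategory of $\mathsf{GBA_M}$ of those $\alpha:M_1\to M_2$ such that for every finite (possibly empty) $S\subseteq M_1$ and every upper bound $x$ of $\alpha[S]$ there is an upper bound $c$ of $S$ with $\alpha(c)\le x$. *Spaces.* A Priestley space is a compact space with a partial order such that $x\not\le y$ implies that some clopen upset contains $x$ and misses $y$. A *pointed generalized Priestley space* is a Priestley space $X$ with a point $m$ and a subset $X_0\subseteq X\setminus\{m\}$ such that, calling a clopen upset $U$ *admissible* if $\max(X\setminus U)\subseteq X_0$, writing $\mathcal A(X)$ for the set of admissible clopen upsets and $\mathcal I_x=\{U\in\mathcal A(X): x\notin U\}$: $m$ is the greatest element of $X$; $X_0$ is dense in $X\setminus\{m\}$; every $x\ne m$ is below some $y\in X_0$; $x\in X_0$ iff $\mathcal I_x$ is nonempty and directed under inclusion; and $x\le y$ iff every $U\in\mathcal A(X)$ containing $x$ contains $y$. It is a *pointed Stone space* if $X_0=X\setminus\{m\}$ and the restriction of $\le$ to $X_0$ is the identity. For $R\subseteq X\times Y$ put $\Box_RU=\{x: R[x]\subseteq U\}$. A *generalized Priestley morphism* $R\subseteq X\times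 Y$ is a relation such that if not $xRy$, then some $U\in\mathcal A(Y)$ has $R[x]\subseteq U$ and $y\notin U$, and such that $U\in\mathcal A(Y)$ implies $\Box_RU\in\mathcal A(X)$. Identities are $\le$, and the composition $S*R$ of $R\subseteq X\times Y$ and $S\subseteq Y\times Z$ is given by $x(S*R)z$ iff for all $U\in\mathcal A(Z)$, $x\in\Box_R\Box_SU$ implies $z\in U$. A *strong Priestley morphism* is an order-preserving map $f:X\to Y$ with $f^{-1}(U)\in\mathcal A(X)$ for all $U\in\mathcal A(Y)$. Let $\mathsf{PStone}$ be the category of pointed Stone spaces and generalized Priestley morphisms, $\mathsf{PStone_S}$ the category of pointed Stone spaces and strong Priestley morphisms (with usual composition), and $\mathsf{PStone_P}$ the wide subcategory of $\mathsf{PStone_S}$ of those $f$ with $f[X_0]\subseteq Y_0$. **Theorem.** 1. $\mathsf{GStoneFrm_J}$ is equivalent to $\mathsf{GBA_M}$ and dually equivalent to $\mathsf{PStone}$. 2. $\mathsf{GStoneFrm_S}$ is equivalent to $\mathsf{GBA}$ and dually equivalent to $\mathsf{PStone_S}$. 3. $\mathsf{GStoneFrm}$ is equivalent to $\mathsf{GBA_P}$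 and dually equivalent to $\mathsf{PStone_P}$. -/

import Mathlib

open CategoryTheory

universe u

namespace PointedStone

/-! ### Distributive meet-semilattices and generalized Boolean algebras

`SemilatInfCat` is Mathlib's category of meet-semilattices with top and maps that preserve all
finite meets (including the top). -/

/-- A meet-semilattice is distributive if `a ⊓ b ≤ c` implies `c = a' ⊓ b'` for some
`a' ≥ a` and `b' ≥ b`. -/
def IsDistributive : ObjectProperty SemilatInfCat.{u} := fun M =>
  ∀ a b c : M, a ⊓ b ≤ c → ∃ a' b' : M, a ≤ a' ∧ b ≤ b' ∧ a' ⊓ b' = c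

/-- Distributive meet-semilattices (with top), with all meet-semilattice homomorphisms. -/
abbrev DMS : Type (u + 1) := IsDistributive.{u}.FullSubcategory

/-- The map underlying a morphism of distributive meet-semilattices. -/
def DMS.toFun {M N : DMS.{u}} (α : M ⟶ N) : M.obj → N.obj := fun x =>
  (show InfTopHom M.obj N.obj from α.hom) x

theorem DMS.toFun_mono {M N : DMS.{u}} (α : M ⟶ N) : Monotone (DMS.toFun α) := fun _ _ h =>
  OrderHomClass.mono (show InfTopHom M.obj N.obj from α.hom) h

/-- The morphism preserves all existing joins of nonempty finite sets. -/
def IsSupMorphism : MorphismProperty DMS.{u} := fun M _ α =>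
  ∀ S : Set M.obj, S.Finite → S.Nonempty → ∀ a : M.obj, IsLUB S a →
    IsLUB (DMS.toFun α '' S) (DMS.toFun α a)

/-- For every finite set `S` (possibly empty) and every upper bound `x` of `α[S]` there is an
upper bound `c` of `S` with `α c ≤ x`. -/
def IsPMorphism : MorphismProperty DMS.{u} := fun M N α =>
  ∀ S : Set M.obj, S.Finite → ∀ x : N.obj, x ∈ upperBounds (DMS.toFun α '' S) →
    ∃ c : M.obj, c ∈ upperBounds S ∧ DMS.toFun α c ≤ x

instance : IsSupMorphism.{u}.IsMultiplicative where
  id_mem M := by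
    intro S _ _ a ha
    have h : DMS.toFun (𝟙 M) = id := rfl
    rw [h, Set.image_id]
    exact ha
  comp_mem {M N K} α β hα hβ := by
    intro S hS hne a ha
    have h : DMS.toFun (α ≫ β) = DMS.toFun β ∘ DMS.toFun α := rfl
    rw [h, Set.image_comp]
    exact hβ _ (hS.image _) (hne.image _) _ (hα S hS hne a ha)

instance : IsPMorphism.{u}.IsMultiplicative where
  id_mem M := by
    intro S _ x hx
    have h : DMS.toFun (𝟙 M) = id := rfl
    rw [h, Set.image_id] at hx
    exact ⟨x, hx, le_rfl⟩
  comp_mem {M N K} α β hα hβ := by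
    intro S hS x hx
    have h : DMS.toFun (α ≫ β) = DMS.toFun β ∘ DMS.toFun α := rfl
    rw [h, Set.image_comp] at hx
    obtain ⟨c, hc, hcx⟩ := hβ _ (hS.image _) x hx
    obtain ⟨d, hd, hdc⟩ := hα S hS c hc
    exact ⟨d, hd, (DMS.toFun_mono β hdc).trans hcx⟩

/-- Distributive meet-semilattices with the morphisms that preserve existing nonempty finite
joins. -/
abbrev DMSS : Type (u + 1) := WideSubcategory IsSupMorphism.{u}

/-- Distributive meet-semilattices with the morphisms satisfying `IsPMorphism`. -/
abbrev DMSP : Type (u + 1) := WideSubcategory IsPMorphism.{u}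

/-- A distributive meet-semilattice `M` is a generalized Boolean algebra if it is a lattice and
every interval `[a, ⊤]` is complemented (hence, by distributivity, a Boolean algebra). -/
def IsGenBoolean (M : DMS.{u}) : Prop :=
  (∀ a b : M.obj, ∃ c : M.obj, IsLUB {a, b} c) ∧
    ∀ a x : M.obj, a ≤ x → ∃ y : M.obj, a ≤ y ∧ x ⊓ y = a ∧ IsLUB {x, y} ⊤

/-- Generalized Boolean algebras with maps preserving finite meets. -/
abbrev GBAM : Type (u + 1) :=
  ObjectProperty.FullSubcategory (fun M : DMS.{u} => IsGenBoolean M)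

/-- Generalized Boolean algebras with lattice homomorphisms preserving the top. -/
abbrev GBA : Type (u + 1) :=
  ObjectProperty.FullSubcategory (fun M : DMSS.{u} => IsGenBoolean M.obj)

/-- Generalized Boolean algebras with the morphisms satisfying `IsPMorphism`. -/
abbrev GBAP : Type (u + 1) :=
  ObjectProperty.FullSubcategory (fun M : DMSP.{u} => IsGenBoolean M.obj)

/-! ### Algebraic frames and generalized Stone frames -/

/-- Algebraic frames: the objects of the category whose morphisms preserve arbitrary joins and
compact elements. -/
structure AlgFrmJ : Type (u + 1) where
  carrier : Type u
  [frame : Order.Frame carrier]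
  [algebraic : IsCompactlyGenerated carrier]

attribute [instance] AlgFrmJ.frame AlgFrmJ.algebraic

/-- Maps preserving arbitrary joins and compact elements. -/
@[ext]
structure AlgFrmJ.Hom (L M : AlgFrmJ.{u}) : Type u where
  toHom : sSupHom L.carrier M.carrier
  map_compact : ∀ k : L.carrier, IsCompactElement k → IsCompactElement (toHom k)

instance : Category.{u} AlgFrmJ.{u} where
  Hom L M := AlgFrmJ.Hom L M
  id L := ⟨sSupHom.id L.carrier, fun _ hk => hk⟩
  comp f g := ⟨g.toHom.comp f.toHom, fun k hk => g.map_compact _ (f.map_compact k hk)⟩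

/-- If `S` is a nonempty finite set of compact elements whose meet is compact, then the morphism
preserves the meet of `S`. -/
def PreservesCompactMeets : MorphismProperty AlgFrmJ.{u} := fun L _ α =>
  ∀ S : Set L.carrier, S.Finite → S.Nonempty → (∀ k ∈ S, IsCompactElement k) →
    IsCompactElement (sInf S) → α.toHom (sInf S) = sInf (α.toHom '' S)

/-- The morphism preserves all finite meets, that is, it is a frame homomorphism. -/
def PreservesFiniteMeets : MorphismProperty AlgFrmJ.{u} := fun L _ α =>
  α.toHom ⊤ = ⊤ ∧ ∀ a b : L.carrier, α.toHom (a ⊓ b) = α.toHom a ⊓ α.toHom b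

instance : PreservesCompactMeets.{u}.IsMultiplicative where
  id_mem L := by
    intro S _ _ _ _
    change sInf S = sInf (id '' S)
    rw [Set.image_id]
  comp_mem {L M N} α β hα hβ := by
    intro S hS hne hk hm
    change β.toHom (α.toHom (sInf S)) = sInf ((β.toHom ∘ α.toHom) '' S)
    have h := hα S hS hne hk hm
    rw [Set.image_comp, h]
    refine hβ _ (hS.image _) (hne.image _) ?_ ?_
    · rintro _ ⟨k, hkS, rfl⟩
      exact α.map_compact k (hk k hkS)
    · rw [← h]
      exact α.map_compact _ hm

instance : PreservesFiniteMeets.{u}.IsMultiplicative where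
  id_mem L := ⟨rfl, fun _ _ => rfl⟩
  comp_mem {L M N} α β hα hβ := by
    refine ⟨?_, fun a b => ?_⟩
    · change β.toHom (α.toHom ⊤) = ⊤
      rw [hα.1, hβ.1]
    · change β.toHom (α.toHom (a ⊓ b)) = β.toHom (α.toHom a) ⊓ β.toHom (α.toHom b)
      rw [hα.2, hβ.2]

/-- Algebraic frames with the morphisms satisfying `PreservesCompactMeets`. -/
abbrev AlgFrmS : Type (u + 1) := WideSubcategory PreservesCompactMeets.{u}

/-- Algebraic frames with frame homomorphisms preserving compact elements. -/
abbrev AlgFrm : Type (u + 1) := WideSubcategory PreservesFiniteMeets.{u}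

/-- The complemented elements are join-dense. -/
def IsZeroDimensional (L : AlgFrmJ.{u}) : Prop :=
  ∀ a : L.carrier, ∃ S : Set L.carrier, (∀ x ∈ S, IsComplemented x) ∧ sSup S = a

/-- Generalized Stone frames, that is, algebraic zero-dimensional frames, with maps preserving
arbitrary joins and compact elements. -/
abbrev GStoneFrmJ : Type (u + 1) :=
  ObjectProperty.FullSubcategory (fun L : AlgFrmJ.{u} => IsZeroDimensional L)

/-- Generalized Stone frames with the morphisms satisfying `PreservesCompactMeets`. -/
abbrev GStoneFrmS : Type (u + 1) :=
  ObjectProperty.FullSubcategory (fun L : AlgFrmS.{u} => IsZeroDimensional L.obj)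

/-- Generalized Stone frames with frame homomorphisms preserving compact elements. -/
abbrev GStoneFrm : Type (u + 1) :=
  ObjectProperty.FullSubcategory (fun L : AlgFrm.{u} => IsZeroDimensional L.obj)

/-! ### Pointed generalized Priestley spaces and pointed Stone spaces -/

/-- A clopen upset `U` is admissible, relative to `X₀`, if all maximal elements of its complement
lie in `X₀`. -/
def Admissible {X : Type u} [TopologicalSpace X] [PartialOrder X] (X₀ : Set X) (U : Set X) :
    Prop :=
  IsClopen U ∧ IsUpperSet U ∧ ∀ x : X, Maximal (fun y => y ∉ U) x → x ∈ X₀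

/-- The admissible clopen upsets that miss `x`. -/
def admissibleMissing {X : Type u} [TopologicalSpace X] [PartialOrder X] (X₀ : Set X) (x : X) :
    Set (Set X) :=
  {U | Admissible X₀ U ∧ x ∉ U}

/-- Pointed generalized Priestley spaces. -/
structure PGPSpace : Type (u + 1) where
  carrier : Type u
  [topology : TopologicalSpace carrier]
  [order : PartialOrder carrier]
  [compact : CompactSpace carrier]
  [priestley : PriestleySpace carrier]
  /-- the distinguished subset -/
  X₀ : Set carrier
  /-- the distinguished point -/
  m : carrier
  le_m : ∀ x : carrier, x ≤ m
  m_notMem : m ∉ X₀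
  dense : ∀ x : carrier, x ≠ m → x ∈ closure X₀
  order_dense : ∀ x : carrier, x ≠ m → ∃ y ∈ X₀, x ≤ y
  mem_X₀_iff : ∀ x : carrier, x ∈ X₀ ↔
    (admissibleMissing X₀ x).Nonempty ∧ DirectedOn (· ⊆ ·) (admissibleMissing X₀ x)
  le_iff : ∀ x y : carrier, x ≤ y ↔ ∀ U : Set carrier, Admissible X₀ U → x ∈ U → y ∈ U

attribute [instance] PGPSpace.topology PGPSpace.order PGPSpace.compact PGPSpace.priestley

/-- `𝒜(X)`: the admissible clopen upsets of `X`. -/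
def PGPSpace.adm (X : PGPSpace.{u}) : Set (Set X.carrier) := {U | Admissible X.X₀ U}

/-- `□_R U = {x | R[x] ⊆ U}`. -/
def box {X Y : Type u} (R : X → Y → Prop) (U : Set Y) : Set X := {x | ∀ y, R x y → y ∈ U}

/-- Generalized Priestley morphisms. -/
@[ext]
structure GPMor (X Y : PGPSpace.{u}) : Type u where
  rel : X.carrier → Y.carrier → Prop
  separated : ∀ x y, ¬ rel x y → ∃ U ∈ Y.adm, (∀ z, rel x z → z ∈ U) ∧ y ∉ U
  box_mem : ∀ U ∈ Y.adm, box rel U ∈ X.adm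

/-- The composition `S * R` of relations, relative to the admissible clopen upsets of `Z`. -/
def starRel {X Y Z : PGPSpace.{u}} (S : Y.carrier → Z.carrier → Prop)
    (R : X.carrier → Y.carrier → Prop) (x : X.carrier) (z : Z.carrier) : Prop :=
  ∀ U ∈ Z.adm, x ∈ box R (box S U) → z ∈ U

theorem box_starRel {X Y Z : PGPSpace.{u}} (S : Y.carrier → Z.carrier → Prop)
    (R : X.carrier → Y.carrier → Prop) {U : Set Z.carrier} (hU : U ∈ Z.adm) :
    box (starRel S R) U = box R (box S U) := by
  ext x
  constructor
  · intro h y hxy z hyz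
    exact h z fun V _ hV => hV y hxy z hyz
  · intro h z hz
    exact hz U hU h

theorem box_le {X : PGPSpace.{u}} {U : Set X.carrier} (hU : IsUpperSet U) :
    box (fun x y : X.carrier => x ≤ y) U = U := by
  ext x
  exact ⟨fun h => h x le_rfl, fun h _ hxy => hU hxy h⟩

/-- The identity morphism is the order relation. -/
def GPMor.id (X : PGPSpace.{u}) : GPMor X X where
  rel x y := x ≤ y
  separated x y h := by
    rw [X.le_iff] at h
    push Not at h
    obtain ⟨U, hU, hx, hy⟩ := h
    exact ⟨U, hU, fun z hz => hU.2.1 hz hx, hy⟩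
  box_mem U hU := by
    rw [box_le hU.2.1]
    exact hU

/-- The composition `S * R` of generalized Priestley morphisms. -/
def GPMor.comp {X Y Z : PGPSpace.{u}} (S : GPMor Y Z) (R : GPMor X Y) : GPMor X Z where
  rel := starRel S.rel R.rel
  separated x z h := by
    unfold starRel at h
    push Not at h
    obtain ⟨U, hU, hx, hz⟩ := h
    exact ⟨U, hU, fun w hw => hw U hU hx, hz⟩
  box_mem U hU := by
    rw [box_starRel S.rel R.rel hU]
    exact R.box_mem _ (S.box_mem U hU)

/-- A generalized Priestley morphism is determined by `□` on admissible clopen upsets. -/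
theorem GPMor.ext_box {X Y : PGPSpace.{u}} {R S : GPMor X Y}
    (h : ∀ U ∈ Y.adm, box R.rel U = box S.rel U) : R = S := by
  have key : ∀ (R S : GPMor X Y), (∀ U ∈ Y.adm, box R.rel U = box S.rel U) →
      ∀ x y, R.rel x y → S.rel x y := by
    intro R S h x y hR
    by_contra hS
    obtain ⟨U, hU, hx, hy⟩ := S.separated x y hS
    have hx' : x ∈ box R.rel U := by
      rw [h U hU]
      exact hx
    exact hy (hx' y hR)
  apply GPMor.ext
  funext x y
  exact propext ⟨key R S h x y, key S R (fun U hU => (h U hU).symm) x y⟩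

theorem GPMor.box_comp {X Y Z : PGPSpace.{u}} (S : GPMor Y Z) (R : GPMor X Y)
    {U : Set Z.carrier} (hU : U ∈ Z.adm) :
    box (GPMor.comp S R).rel U = box R.rel (box S.rel U) :=
  box_starRel S.rel R.rel hU

theorem GPMor.box_id {X : PGPSpace.{u}} {U : Set X.carrier} (hU : U ∈ X.adm) :
    box (GPMor.id X).rel U = U :=
  box_le hU.2.1

/-- Pointed generalized Priestley spaces with generalized Priestley morphisms. -/
structure PGPS : Type (u + 1) where
  space : PGPSpace.{u}

instance : Category.{u} PGPS.{u} where
  Hom X Y := GPMor X.space Y.space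
  id X := GPMor.id X.space
  comp R S := GPMor.comp S R
  id_comp R := GPMor.ext_box fun U hU => by
    rw [GPMor.box_comp _ _ hU, GPMor.box_id (R.box_mem U hU)]
  comp_id R := GPMor.ext_box fun U hU => by
    rw [GPMor.box_comp _ _ hU, GPMor.box_id hU]
  assoc R S T := GPMor.ext_box fun U hU => by
    rw [GPMor.box_comp _ _ hU, GPMor.box_comp _ _ (T.box_mem U hU), GPMor.box_comp _ _ hU,
      GPMor.box_comp _ _ hU]

/-- Strong Priestley morphisms: order-preserving maps such that preimages of admissible clopen
upsets are admissible clopen upsets. -/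
@[ext]
structure StrongMor (X Y : PGPSpace.{u}) : Type u where
  toHom : X.carrier →o Y.carrier
  preimage_mem : ∀ U ∈ Y.adm, toHom ⁻¹' U ∈ X.adm

/-- Pointed generalized Priestley spaces with strong Priestley morphisms. -/
structure PGPSS : Type (u + 1) where
  space : PGPSpace.{u}

instance : Category.{u} PGPSS.{u} where
  Hom X Y := StrongMor X.space Y.space
  id X := ⟨OrderHom.id, fun _ hU => hU⟩
  comp f g := ⟨g.toHom.comp f.toHom, fun U hU => f.preimage_mem _ (g.preimage_mem U hU)⟩

/-- The strong Priestley morphism `f` satisfies `f[X₀] ⊆ Y₀`. -/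
def MapsX₀ : MorphismProperty PGPSS.{u} := fun X Y f =>
  ∀ x ∈ X.space.X₀, f.toHom x ∈ Y.space.X₀

instance : MapsX₀.{u}.IsMultiplicative where
  id_mem _ := fun _ hx => hx
  comp_mem f _ hf hg := fun x hx => hg (f.toHom x) (hf x hx)

/-- Pointed generalized Priestley spaces with strong Priestley morphisms that map the
distinguished subset into the distinguished subset. -/
abbrev PGPSP : Type (u + 1) := WideSubcategory MapsX₀.{u}

/-- A pointed generalized Priestley space is a pointed Priestley space if `X₀ = X ∖ {m}`. -/
def IsPointedPriestley (X : PGPSpace.{u}) : Prop := X.X₀ = {X.m}ᶜ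

/-- A pointed Priestley space is a pointed Stone space if `≤` restricts to the identity on
`X₀ = X ∖ {m}` (every point is below `m`). -/
def IsPointedStone (X : PGPSpace.{u}) : Prop :=
  IsPointedPriestley X ∧ ∀ x ∈ X.X₀, ∀ y ∈ X.X₀, x ≤ y → x = y

/-- Pointed Stone spaces with generalized Priestley morphisms. -/
abbrev PStone : Type (u + 1) :=
  ObjectProperty.FullSubcategory (fun X : PGPS.{u} => IsPointedStone X.space)

/-- Pointed Stone spaces with strong Priestley morphisms. -/
abbrev PStoneS : Type (u + 1) :=
  ObjectProperty.FullSubcategory (fun X : PGPSS.{u} => IsPointedStone X.space)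

/-- Pointed Stone spaces with strong Priestley morphisms satisfying `f[X₀] ⊆ Y₀`. -/
abbrev PStoneP : Type (u + 1) :=
  ObjectProperty.FullSubcategory (fun X : PGPSP.{u} => IsPointedStone X.obj.space)

end PointedStone

open PointedStone

/-!
In a generalized Stone frame the compact elements are complemented, hence closed under binary meets,
and their order dual is a generalized Boolean algebra. A join-preserving map that preserves compact
elements is the same thing as a map of compact elements that preserves finite joins, because it is
determined by, and extends freely from, the compact elements. Under this correspondence, preserving
compact meets becomes preserving binary joins in the dual, and preserving all finite meets becomes,
in addition, being cofinal, which is the case `S = ∅` of `IsPMorphism`.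

In a pointed Stone space the admissible clopen upsets are the clopen sets that contain `m`, and they
form a generalized Boolean algebra. A compactness argument recovers every finite-meet-preserving map
`α` between such algebras as the box of the relation `x R y ↔ ∀ U, x ∈ α U → y ∈ U`. If `α` also
preserves binary joins, then among the points related to `x` there is one contained in exactly those
`U` with `x ∈ α U`, so that `α` is given by preimages under a function; this function preserves the
complement of `m` exactly when `α` is cofinal.

Every generalized Boolean algebra arises from a space: the points of its spectrum are the prime
filters together with the improper filter, which plays the role of `m`. It arises from a frame as
well, namely from the open subsets of the spectrum without `m`, whose compact open sets are the
complements of the admissible clopen upsets.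
-/

namespace PointedStone

open OrderDual Topology
open CompleteLattice hiding isLUB_sSup

section FullWide

variable {C A : Type*} [Category* C] [Category* A] (P : ObjectProperty C) (W : MorphismProperty C)
  [W.IsMultiplicative]

/-- The category of the objects of `C` satisfying `P` and the morphisms of `C` satisfying `W`,
encoded as a full subcategory of a wide subcategory. -/
abbrev FullWideSubcategory : Type _ :=
  ObjectProperty.FullSubcategory fun X : WideSubcategory W => P X.obj

/-- The inclusion of `FullWideSubcategory P W` into the full subcategory on `P`. -/
def forgetWide : FullWideSubcategory P W ⥤ P.FullSubcategory :=
  P.lift (ObjectProperty.ι _ ⋙ wideSubcategoryInclusion W) ObjectProperty.FullSubcategory.property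

instance : (forgetWide P W).Faithful where
  map_injective h := ObjectProperty.hom_ext _ (WideSubcategory.hom_ext _ (congrArg (·.hom) h))

instance : (forgetWide P W).EssSurj where
  mem_essImage X := ⟨⟨⟨X.obj⟩, X.property⟩, ⟨Iso.refl _⟩⟩

variable {P W}

theorem exists_forgetWide_map_eq {X Y : FullWideSubcategory P W}
    (g : (forgetWide P W).obj X ⟶ (forgetWide P W).obj Y) (hg : W g.hom) :
    ∃ f : X ⟶ Y, (forgetWide P W).map f = g :=
  ⟨ObjectProperty.homMk ⟨g.hom, hg⟩, rfl⟩

/-- A functor into the full subcategory on `P` whose values on morphisms satisfy `W`, as a functor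
into `FullWideSubcategory P W`. -/
def liftWide (F : A ⥤ P.FullSubcategory) (hF : ∀ {X Y : A} (f : X ⟶ Y), W (F.map f).hom) :
    A ⥤ FullWideSubcategory P W where
  obj X := ⟨⟨(F.obj X).obj⟩, (F.obj X).property⟩
  map f := ObjectProperty.homMk ⟨(F.map f).hom, hF f⟩
  map_id X := by
    ext
    exact congrArg (·.hom) (F.map_id X)
  map_comp f g := by
    ext
    exact congrArg (·.hom) (F.map_comp f g)

theorem isEquivalence_liftWide (F : A ⥤ P.FullSubcategory) [F.Faithful] [F.EssSurj]
    {hF : ∀ {X Y : A} (f : X ⟶ Y), W (F.map f).hom}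
    (hfull : ∀ {X Y : A} (g : F.obj X ⟶ F.obj Y), W g.hom → ∃ f, F.map f = g)
    (hiso : MorphismProperty.isomorphisms C ≤ W) : (liftWide F hF).IsEquivalence where
  faithful := ⟨fun h => F.map_injective (ObjectProperty.hom_ext _ (congrArg (·.hom.hom) h))⟩
  full := ⟨fun g => by
    obtain ⟨f, hf⟩ := hfull (ObjectProperty.homMk g.hom.hom) g.hom.property
    refine ⟨f, ?_⟩
    ext
    exact congrArg (·.hom) hf⟩
  essSurj := ⟨fun Y => by
    obtain ⟨X, ⟨i⟩⟩ := Functor.EssSurj.mem_essImage (F := F) ((forgetWide P W).obj Y)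
    let j := P.ι.mapIso i
    exact ⟨X, ⟨ObjectProperty.isoMk _ (WideSubcategory.isoMk j
      (hiso _ (.infer_property j.hom)) (hiso _ (.infer_property j.inv)))⟩⟩⟩

end FullWide

theorem DMS.hom_ext {M N : DMS.{u}} {α β : M ⟶ N} (h : ∀ x, DMS.toFun α x = DMS.toFun β x) :
    α = β :=
  ObjectProperty.hom_ext _ (InfTopHom.ext h)

theorem DMS.toFun_hom_toFun_inv {M N : DMS.{u}} (e : M ≅ N) (x : N.obj) :
    DMS.toFun e.hom (DMS.toFun e.inv x) = x :=
  congrArg (fun α => DMS.toFun α x) e.inv_hom_id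

theorem isPMorphism_le_isSupMorphism : IsPMorphism.{u} ≤ IsSupMorphism := by
  intro M N α hα S hS _ a ha
  refine ⟨(DMS.toFun_mono α).mem_upperBounds_image ha.1, fun x hx => ?_⟩
  obtain ⟨c, hc, hcx⟩ := hα S hS x hx
  exact (DMS.toFun_mono α (ha.2 hc)).trans hcx

theorem isomorphisms_le_isPMorphism : MorphismProperty.isomorphisms DMS.{u} ≤ IsPMorphism := by
  rintro M N α (_ : IsIso α) S - x hx
  refine ⟨DMS.toFun (inv α) x, fun s hs => ?_, (DMS.toFun_hom_toFun_inv (asIso α) x).le⟩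
  calc s = DMS.toFun (inv α) (DMS.toFun α s) :=
        (DMS.toFun_hom_toFun_inv (asIso α).symm s).symm
    _ ≤ DMS.toFun (inv α) x := DMS.toFun_mono _ (hx ⟨s, hs, rfl⟩)

section DistribLattice

variable {M N : Type u} [DistribLattice M] [OrderTop M] [DistribLattice N] [OrderTop N]

/-- A distributive lattice with top, as a distributive meet-semilattice. -/
abbrev DMS.of (M : Type u) [DistribLattice M] [OrderTop M] : DMS.{u} where
  obj := .of M
  property a b c h := ⟨a ⊔ c, b ⊔ c, le_sup_left (α := M), le_sup_left (α := M),
    (sup_inf_right (α := M) a b c).symm.trans (sup_eq_right.2 h)⟩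

/-- A meet-semilattice homomorphism between distributive lattices, as a morphism of `DMS`. -/
abbrev DMS.ofHom (f : InfTopHom M N) : DMS.of M ⟶ DMS.of N :=
  ObjectProperty.homMk f

theorem isGenBoolean_of (h : ∀ a x : M, a ≤ x → ∃ y, x ⊓ y = a ∧ x ⊔ y = ⊤) :
    IsGenBoolean (DMS.of M) where
  left a b := ⟨(a ⊔ b : M), isLUB_pair⟩
  right a x hax := by
    obtain ⟨y, hinf, hsup⟩ := h a x hax
    exact ⟨y, hinf.ge.trans inf_le_right, hinf, hsup ▸ isLUB_pair (γ := M)⟩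

theorem exists_upperBound_map_le {f : InfTopHom M N} (hf : ∀ a b, f (a ⊔ b) = f a ⊔ f b)
    {S : Set M} (hS : S.Finite) {x : N} (hx : x ∈ upperBounds (f '' S)) {c₀ : M} (hc₀ : f c₀ ≤ x) :
    ∃ c ∈ upperBounds S, f c ≤ x := by
  induction S, hS using Set.Finite.induction_on with
  | empty => exact ⟨c₀, by simp, hc₀⟩
  | @insert s S _ _ ih =>
    rw [Set.image_insert_eq, upperBounds_insert] at hx
    obtain ⟨c, hc, hcx⟩ := ih hx.2
    have hsc : s ⊔ c ∈ upperBounds (insert s S) := by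
      rw [upperBounds_insert]
      exact ⟨le_sup_left, fun t ht => (hc ht).trans le_sup_right⟩
    exact ⟨s ⊔ c, hsc, (hf s c).trans_le (sup_le hx.1 hcx)⟩

theorem isSupMorphism_ofHom_iff {f : InfTopHom M N} :
    IsSupMorphism (DMS.ofHom f) ↔ ∀ a b, f (a ⊔ b) = f a ⊔ f b := by
  refine ⟨fun h a b => ?_, fun h S hS ⟨s, hs⟩ a ha => ?_⟩
  · have hlub := h {a, b} (Set.toFinite _) (Set.insert_nonempty _ _) (a ⊔ b : M) isLUB_pair
    rw [Set.image_pair] at hlub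
    exact hlub.unique isLUB_pair
  · refine ⟨(DMS.toFun_mono (DMS.ofHom f)).mem_upperBounds_image ha.1, fun x hx => ?_⟩
    obtain ⟨c, hc, hcx⟩ := exists_upperBound_map_le h hS hx (hx ⟨s, hs, rfl⟩)
    exact (OrderHomClass.mono f (ha.2 hc)).trans hcx

theorem isPMorphism_ofHom_iff {f : InfTopHom M N} :
    IsPMorphism (DMS.ofHom f) ↔ (∀ a b, f (a ⊔ b) = f a ⊔ f b) ∧ ∀ x, ∃ c, f c ≤ x := by
  refine ⟨fun h => ⟨isSupMorphism_ofHom_iff.1 (isPMorphism_le_isSupMorphism _ h), fun x => ?_⟩,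
    fun ⟨hsup, hcof⟩ S hS x hx => ?_⟩
  · obtain ⟨c, -, hc⟩ := h ∅ Set.finite_empty x (by simp)
    exact ⟨c, hc⟩
  · exact exists_upperBound_map_le hsup hS hx (hcof x).choose_spec

end DistribLattice

section CompactElement

variable {L N : Type*} [CompleteLattice L] [CompleteLattice N]

theorem isCompactElement_bot : IsCompactElement (⊥ : L) :=
  isCompactElement_finsetSup (f := id) ∅ (by simp)

theorem isCompactElement_sup {a b : L} (ha : IsCompactElement a) (hb : IsCompactElement b) :
    IsCompactElement (a ⊔ b) := by
  classical
  simpa using isCompactElement_finsetSup (f := id) {a, b} (by simp [ha, hb])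

theorem exists_le_map_of_le_sSup_image {ι : Type*} [SemilatticeSup ι] {S : Set ι}
    (hS : SupClosed S) (hne : S.Nonempty) {f : ι → L} (hf : Monotone f) {k : L}
    (hk : IsCompactElement k) (hkS : k ≤ sSup (f '' S)) : ∃ i ∈ S, k ≤ f i := by
  have hdir : DirectedOn (· ≤ ·) (f '' S) :=
    directedOn_image.2 (hS.directedOn.mono' fun _ _ _ _ hij => hf hij)
  obtain ⟨_, ⟨i, hi, rfl⟩, hki⟩ := hk _ _ (hne.image f) hdir (isLUB_sSup _) hkS
  exact ⟨i, hi, hki⟩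

/-- The compact elements of a complete lattice, with the induced order. -/
abbrev CompactElement (L : Type*) [CompleteLattice L] : Type _ := {k : L // IsCompactElement k}

instance : SemilatticeSup (CompactElement L) :=
  Subtype.semilatticeSup fun _ _ => isCompactElement_sup

instance : OrderBot (CompactElement L) := Subtype.orderBot isCompactElement_bot

/-- The restriction to compact elements of a join-preserving map that preserves them. -/
def restrictCompact (f : sSupHom L N) (hf : ∀ k, IsCompactElement k → IsCompactElement (f k)) :
    SupBotHom (CompactElement L) (CompactElement N) where
  toFun k := ⟨f k, hf k k.2⟩
  map_sup' a b := Subtype.ext (map_sup f a.1 b.1)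
  map_bot' := Subtype.ext (map_bot f)

variable [IsCompactlyGenerated L]

theorem map_eq_sSup_image_compact (f : sSupHom L N) (a : L) :
    f a = sSup (f '' {k | IsCompactElement k ∧ k ≤ a}) := by
  rw [← map_sSup, sSup_compact_le_eq]

theorem exists_compact_le_map (f : sSupHom L N) {x : N} (hx : IsCompactElement x) {a : L}
    (h : x ≤ f a) : ∃ k, IsCompactElement k ∧ k ≤ a ∧ x ≤ f k := by
  rw [map_eq_sSup_image_compact f a] at h
  have hclosed : SupClosed {k : L | IsCompactElement k ∧ k ≤ a} := fun k hk l hl =>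
    ⟨isCompactElement_sup hk.1 hl.1, sup_le hk.2 hl.2⟩
  obtain ⟨k, ⟨hk, hka⟩, hxk⟩ := exists_le_map_of_le_sSup_image hclosed
    ⟨⊥, isCompactElement_bot, bot_le⟩ (OrderHomClass.mono f) hx h
  exact ⟨k, hk, hka, hxk⟩

theorem gc_extendCompact (g : SupBotHom (CompactElement L) (CompactElement N)) :
    GaloisConnection (fun a : L => sSup ((fun k => (g k : N)) '' {k | (k : L) ≤ a}))
      (fun y : N => sSup ((↑) '' {k : CompactElement L | (g k : N) ≤ y})) := by
  intro a y
  have hclosed : SupClosed {k : CompactElement L | (g k : N) ≤ y} := fun k hk l hl =>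
    (congrArg Subtype.val (map_sup g k l)).trans_le (sup_le (α := N) hk hl)
  have hne : {k : CompactElement L | (g k : N) ≤ y}.Nonempty :=
    ⟨⊥, (congrArg Subtype.val (map_bot g)).trans_le bot_le⟩
  simp only [sSup_le_iff, Set.forall_mem_image]
  refine ⟨fun h => le_iff_compact_le_imp.2 fun k hk hka => le_sSup ⟨⟨k, hk⟩, h hka, rfl⟩,
    fun h k hk => ?_⟩
  obtain ⟨l, hl, hkl⟩ :=
    exists_le_map_of_le_sSup_image hclosed hne (Subtype.mono_coe _) k.2 (hk.trans h)
  exact le_trans (α := N) (OrderHomClass.mono g hkl) hl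

/-- The join-preserving extension of a map between compact elements. -/
def extendCompact (g : SupBotHom (CompactElement L) (CompactElement N)) : sSupHom L N where
  toFun a := sSup ((fun k => (g k : N)) '' {k | (k : L) ≤ a})
  map_sSup' S := by rw [(gc_extendCompact g).l_sSup, sSup_image]

theorem extendCompact_coe (g : SupBotHom (CompactElement L) (CompactElement N))
    (k : CompactElement L) : extendCompact g k = g k :=
  IsGreatest.csSup_eq ⟨⟨k, le_rfl, rfl⟩,
    Set.forall_mem_image.2 fun _ hl => OrderHomClass.mono g hl⟩

theorem map_inf_of_map_inf_compact {f : sSupHom L N} [IsCompactlyGenerated N]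
    (hinf : ∀ a b, IsCompactElement a → IsCompactElement b → f (a ⊓ b) = f a ⊓ f b) (a b : L) :
    f (a ⊓ b) = f a ⊓ f b := by
  have hmono : Monotone f := OrderHomClass.mono f
  refine le_antisymm (hmono.map_inf_le a b) (le_iff_compact_le_imp.2 fun x hx hxab => ?_)
  obtain ⟨k, hk, hka, hxk⟩ := exists_compact_le_map f hx (hxab.trans inf_le_left)
  obtain ⟨l, hl, hlb, hxl⟩ := exists_compact_le_map f hx (hxab.trans inf_le_right)
  calc x ≤ f k ⊓ f l := le_inf hxk hxl
    _ = f (k ⊓ l) := (hinf k l hk hl).symm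
    _ ≤ f (a ⊓ b) := hmono (inf_le_inf hka hlb)

end CompactElement

theorem preservesFiniteMeets_iff {L N : AlgFrmJ.{u}} {f : L ⟶ N} :
    PreservesFiniteMeets f ↔
      (∀ a b, IsCompactElement a → IsCompactElement b →
        f.toHom (a ⊓ b) = f.toHom a ⊓ f.toHom b) ∧
      ∀ x, IsCompactElement x → ∃ c, IsCompactElement c ∧ x ≤ f.toHom c := by
  refine ⟨fun ⟨htop, hinf⟩ => ⟨fun a b _ _ => hinf a b, fun x hx => ?_⟩,
    fun ⟨hinf, hcof⟩ => ⟨?_, map_inf_of_map_inf_compact hinf⟩⟩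
  · obtain ⟨c, hc, -, hxc⟩ := exists_compact_le_map f.toHom hx (le_top.trans_eq htop.symm)
    exact ⟨c, hc, hxc⟩
  · refine top_le_iff.1 (le_iff_compact_le_imp.2 fun x hx _ => ?_)
    obtain ⟨c, -, hxc⟩ := hcof x hx
    exact hxc.trans (OrderHomClass.mono f.toHom le_top)

theorem isCompactElement_inf_of_isComplemented {L : Type*} [Order.Frame L] {k c : L}
    (hk : IsCompactElement k) (hc : IsComplemented c) : IsCompactElement (k ⊓ c) := by
  classical
  obtain ⟨d, hd⟩ := hc
  rw [isCompactElement_iff_exists_le_sSup_of_le_sSup] at *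
  intro S hS
  rw [← hd.le_sup_right_iff_inf_left_le, sup_comm, ← sSup_insert] at hS
  obtain ⟨t, ht, hkt⟩ := hk _ hS
  refine ⟨t.erase d, by simpa using ht, hd.le_sup_right_iff_inf_left_le.1 ?_⟩
  calc k ≤ (insert d (t.erase d)).sup id :=
        hkt.trans (Finset.sup_mono (Finset.insert_erase_subset d t))
    _ = (t.erase d).sup id ⊔ d := by rw [Finset.sup_insert, id, sup_comm]

namespace IsZeroDimensional

variable {L : AlgFrmJ.{u}} {a b : L.carrier}

theorem isComplemented (hL : IsZeroDimensional L) (ha : IsCompactElement a) :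
    IsComplemented a := by
  obtain ⟨S, hS, rfl⟩ := hL a
  obtain ⟨t, ht, hat⟩ := (isCompactElement_iff_exists_le_sSup_of_le_sSup _ _).1 ha S le_rfl
  rw [hat.antisymm (Finset.sup_le fun s hs => le_sSup (ht hs))]
  exact Finset.sup_induction isComplemented_bot (fun _ hx _ hy => hx.sup hy)
    fun s hs => hS s (ht hs)

theorem isCompactElement_inf (hL : IsZeroDimensional L) (ha : IsCompactElement a)
    (hb : IsCompactElement b) : IsCompactElement (a ⊓ b) :=
  isCompactElement_inf_of_isComplemented ha (hL.isComplemented hb)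

theorem preservesCompactMeets_iff {N : AlgFrmJ.{u}} (hL : IsZeroDimensional L) {f : L ⟶ N} :
    PreservesCompactMeets f ↔ ∀ a b, IsCompactElement a → IsCompactElement b →
      f.toHom (a ⊓ b) = f.toHom a ⊓ f.toHom b := by
  refine ⟨fun h a b ha hb => ?_, fun h S hS hne hc hcS => ?_⟩
  · simpa [Set.image_pair, ha, hb, hL.isCompactElement_inf] using
      h {a, b} (Set.toFinite _) (Set.insert_nonempty _ _)
  · suffices IsCompactElement (sInf S) ∧ f.toHom (sInf S) = sInf (f.toHom '' S) from this.2
    clear hcS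
    induction S, hS using Set.Finite.induction_on with
    | empty => exact absurd hne Set.not_nonempty_empty
    | @insert a S _ _ ih =>
      obtain ⟨ha, hc⟩ := Set.forall_mem_insert.1 hc
      obtain rfl | hne := S.eq_empty_or_nonempty
      · simpa using ha
      · obtain ⟨hcompact, hmap⟩ := ih hne hc
        rw [Set.image_insert_eq, sInf_insert, sInf_insert, h a _ ha hcompact, hmap]
        exact ⟨hL.isCompactElement_inf ha hcompact, rfl⟩

end IsZeroDimensional

instance (L : GStoneFrmJ.{u}) : DistribLattice (CompactElement L.obj.carrier) where
  __ := Subtype.lattice (fun _ _ => isCompactElement_sup)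
    (fun _ _ => L.property.isCompactElement_inf)
  le_sup_inf _ _ _ := le_sup_inf (α := L.obj.carrier)

theorem isGenBoolean_compactElement (L : GStoneFrmJ.{u}) :
    IsGenBoolean (DMS.of (CompactElement L.obj.carrier)ᵒᵈ) := by
  refine isGenBoolean_of fun a x hax => ?_
  obtain ⟨d, hd⟩ := L.property.isComplemented (ofDual x).2
  have hcompact : IsCompactElement ((ofDual a).1 ⊓ d) :=
    isCompactElement_inf_of_isComplemented (ofDual a).2 ⟨_, hd.symm⟩
  refine ⟨toDual ⟨_, hcompact⟩, Subtype.ext ?_, Subtype.ext ?_⟩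
  · change (ofDual x).1 ⊔ (ofDual a).1 ⊓ d = (ofDual a).1
    rw [sup_inf_left, hd.sup_eq_top, inf_top_eq]
    exact sup_eq_right.2 hax
  · change (ofDual x).1 ⊓ ((ofDual a).1 ⊓ d) = ⊥
    rw [inf_left_comm, hd.inf_eq_bot, inf_bot_eq]

/-- The functor sending a generalized Stone frame to the dual of its lattice of compact elements. -/
def compactFunctor : GStoneFrmJ.{u} ⥤ GBAM.{u} where
  obj L := ⟨DMS.of (CompactElement L.obj.carrier)ᵒᵈ, isGenBoolean_compactElement L⟩
  map f := ObjectProperty.homMk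
    (DMS.ofHom (SupBotHom.dual (restrictCompact f.hom.toHom f.hom.map_compact)))

instance : compactFunctor.{u}.Faithful where
  map_injective {L N f g} h := by
    refine ObjectProperty.hom_ext _ (AlgFrmJ.Hom.ext (sSupHom.ext fun a => ?_))
    rw [map_eq_sSup_image_compact f.hom.toHom, map_eq_sSup_image_compact g.hom.toHom]
    refine congrArg sSup (Set.image_congr fun k hk => ?_)
    exact congrArg Subtype.val (congrArg (fun α => DMS.toFun α.hom
      (toDual (⟨k, hk.1⟩ : CompactElement L.obj.carrier))) h)

instance : compactFunctor.{u}.Full where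
  map_surjective {L N} β := by
    let g : SupBotHom (CompactElement L.obj.carrier) (CompactElement N.obj.carrier) :=
      SupBotHom.dual.symm β.hom.hom
    refine ⟨ObjectProperty.homMk ⟨extendCompact g, fun k hk => ?_⟩,
      ObjectProperty.hom_ext _ (DMS.hom_ext fun x => Subtype.ext (extendCompact_coe g (ofDual x)))⟩
    exact (extendCompact_coe g ⟨k, hk⟩).symm ▸ (g ⟨k, hk⟩).2

theorem isSupMorphism_compactFunctor_map_iff {L N : GStoneFrmJ.{u}} {f : L ⟶ N} :
    IsSupMorphism (compactFunctor.map f).hom ↔ PreservesCompactMeets f.hom := by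
  rw [L.property.preservesCompactMeets_iff]
  exact isSupMorphism_ofHom_iff.trans ⟨fun h a b ha hb => congrArg Subtype.val (h ⟨a, ha⟩ ⟨b, hb⟩),
    fun h a b => Subtype.ext (h _ _ (ofDual a).2 (ofDual b).2)⟩

theorem isPMorphism_compactFunctor_map_iff {L N : GStoneFrmJ.{u}} {f : L ⟶ N} :
    IsPMorphism (compactFunctor.map f).hom ↔ PreservesFiniteMeets f.hom := by
  rw [preservesFiniteMeets_iff]
  exact isPMorphism_ofHom_iff.trans (and_congr
    ⟨fun h a b ha hb => congrArg Subtype.val (h ⟨a, ha⟩ ⟨b, hb⟩),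
      fun h a b => Subtype.ext (h _ _ (ofDual a).2 (ofDual b).2)⟩
    ⟨fun h x hx => let ⟨c, hc⟩ := h ⟨x, hx⟩; ⟨c.1, c.2, hc⟩,
      fun h x => let ⟨c, hc, hxc⟩ := h x.1 x.2; ⟨⟨c, hc⟩, hxc⟩⟩)

section PointedOrder

variable {X : Type u} [TopologicalSpace X] [PartialOrder X] [OrderTop X]

theorem admissible_compl_top_iff (hX : ∀ x y : X, x ≤ y → x = y ∨ y = ⊤) {U : Set X} :
    Admissible {⊤}ᶜ U ↔ IsClopen U ∧ ⊤ ∈ U := by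
  refine ⟨fun ⟨hU, _, hmax⟩ => ⟨hU, ?_⟩, fun ⟨hU, htop⟩ => ⟨hU, fun x y hxy hx => ?_, ?_⟩⟩
  · by_contra htop
    exact hmax ⊤ ⟨htop, fun y _ _ => le_top⟩ rfl
  · obtain rfl | rfl := hX x y hxy
    exacts [hx, htop]
  · rintro x hx rfl
    exact hx.1 htop

variable [CompactSpace X] [PriestleySpace X]

/-- The pointed Stone space given by a Priestley space with a greatest element, the point `m`, all
of whose other elements are pairwise incomparable. -/
def PGPSpace.ofOrderTop (hX : ∀ x y : X, x ≤ y → x = y ∨ y = ⊤) : PGPSpace.{u} where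
  carrier := X
  X₀ := {⊤}ᶜ
  m := ⊤
  le_m _ := le_top
  m_notMem h := h rfl
  dense _ hx := subset_closure hx
  order_dense x hx := ⟨x, hx, le_rfl⟩
  mem_X₀_iff x := by
    simp only [admissibleMissing, admissible_compl_top_iff hX]
    refine ⟨fun hx => ⟨?_, ?_⟩, ?_⟩
    · obtain ⟨U, hU, -, htop, hxU⟩ :=
        exists_isClopen_upper_of_not_le fun h : ⊤ ≤ x => hx (top_le_iff.1 h)
      exact ⟨U, ⟨hU, htop⟩, hxU⟩
    · rintro U ⟨hU, hxU⟩ V ⟨hV, hxV⟩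
      exact ⟨U ∪ V, ⟨⟨hU.1.union hV.1, .inl hU.2⟩, fun h => h.elim hxU hxV⟩,
        Set.subset_union_left, Set.subset_union_right⟩
    · rintro ⟨⟨U, hU, hxU⟩, -⟩ rfl
      exact hxU hU.2
  le_iff x y := by
    refine ⟨fun h U hU hx => hU.2.1 h hx, fun h => ?_⟩
    by_contra hxy
    obtain ⟨U, hU, hup, hx, hy⟩ := exists_isClopen_upper_of_not_le hxy
    exact hy (h U ((admissible_compl_top_iff hX).2 ⟨hU, hup le_top hx⟩) hx)

theorem isPointedStone_ofOrderTop (hX : ∀ x y : X, x ≤ y → x = y ∨ y = ⊤) :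
    IsPointedStone (PGPSpace.ofOrderTop hX) :=
  ⟨rfl, fun x _ y hy hxy => (hX x y hxy).resolve_right hy⟩

end PointedOrder

section Adm

variable {X Y : PGPSpace.{u}}

theorem PGPSpace.inter_mem_adm {U V : Set X.carrier} (hU : U ∈ X.adm) (hV : V ∈ X.adm) :
    U ∩ V ∈ X.adm := by
  refine ⟨hU.1.inter hV.1, hU.2.1.inter hV.2.1, fun x hx => ?_⟩
  by_cases hxU : x ∈ U
  · exact hV.2.2 x ⟨fun h => hx.1 ⟨hxU, h⟩, fun y hy hxy => hx.2 (fun h => hy h.2) hxy⟩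
  · exact hU.2.2 x ⟨hxU, fun y hy hxy => hx.2 (fun h => hy h.1) hxy⟩

theorem PGPSpace.univ_mem_adm : Set.univ ∈ X.adm :=
  ⟨isClopen_univ, isUpperSet_univ, fun _ hx => absurd trivial hx.1⟩

instance : SemilatticeInf X.adm := Subtype.semilatticeInf fun _ _ => PGPSpace.inter_mem_adm

instance : OrderTop X.adm := Subtype.orderTop PGPSpace.univ_mem_adm

/-- The meet-semilattice homomorphism `□_R`. -/
def boxHom (R : GPMor X Y) : InfTopHom Y.adm X.adm where
  toFun U := ⟨box R.rel U, R.box_mem U U.2⟩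
  map_inf' _ _ := Subtype.ext (Set.ext fun _ => forall₂_and)
  map_top' := Subtype.ext (Set.eq_univ_of_forall fun _ _ _ => trivial)

/-- The meet-semilattice homomorphism given by preimages under a strong Priestley morphism. -/
def preimageHom (f : StrongMor X Y) : InfTopHom Y.adm X.adm where
  toFun U := ⟨f.toHom ⁻¹' U, f.preimage_mem U U.2⟩
  map_inf' _ _ := rfl
  map_top' := rfl

theorem boxHom_injective : Function.Injective (boxHom (X := X) (Y := Y)) := fun _ _ h =>
  GPMor.ext_box fun U hU => congrArg (fun α : InfTopHom Y.adm X.adm => (α ⟨U, hU⟩).1) h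

theorem preimageHom_injective : Function.Injective (preimageHom (X := X) (Y := Y)) := by
  intro f g h
  have hmem (x : X.carrier) (U : Set Y.carrier) (hU : U ∈ Y.adm) :
      f.toHom x ∈ U ↔ g.toHom x ∈ U :=
    Set.ext_iff.1 (congrArg (fun α : InfTopHom Y.adm X.adm => (α ⟨U, hU⟩).1) h) x
  refine StrongMor.ext (OrderHom.ext _ _ (funext fun x => le_antisymm ?_ ?_))
  · exact (Y.le_iff _ _).2 fun U hU => (hmem x U hU).1
  · exact (Y.le_iff _ _).2 fun U hU => (hmem x U hU).2

/-- The relation between points dual to a meet-semilattice homomorphism `α`. It is a generalized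
Priestley morphism, with `□` equal to `α`. -/
def dualRel (α : InfTopHom Y.adm X.adm) (x : X.carrier) (y : Y.carrier) : Prop :=
  ∀ U : Y.adm, x ∈ (α U).1 → y ∈ U.1

theorem box_dualRel (α : InfTopHom Y.adm X.adm) (U : Y.adm) : box (dualRel α) U = (α U).1 := by
  refine Set.Subset.antisymm (fun x hx => ?_) fun x hx y hy => hy U hx
  let F : Set Y.adm := {V | x ∈ (α V).1}
  have htop : ⊤ ∈ F := by
    change x ∈ (α ⊤).1
    rw [map_top]
    trivial
  have : Nonempty F := ⟨⟨⊤, htop⟩⟩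
  have hdir : Directed (· ⊇ ·) fun V : F => V.1.1 := fun V W =>
    ⟨⟨V.1 ⊓ W.1, by
      change x ∈ (α (V.1 ⊓ W.1)).1
      rw [map_inf]
      exact ⟨V.2, W.2⟩⟩, Set.inter_subset_left, Set.inter_subset_right⟩
  obtain ⟨V, hVU⟩ := exists_subset_nhds_of_compactSpace hdir (fun V => V.1.2.1.isClosed)
    (U := U.1) fun y hy => U.2.1.isOpen.mem_nhds (hx y fun V hV => Set.mem_iInter.1 hy ⟨V, hV⟩)
  exact OrderHomClass.mono α (show V.1 ≤ U from hVU) V.2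

theorem boxHom_surjective : Function.Surjective (boxHom (X := X) (Y := Y)) := by
  refine fun α => ⟨⟨dualRel α, fun x y hxy => ?_, fun U hU => ?_⟩,
    InfTopHom.ext fun U => Subtype.ext (box_dualRel α U)⟩
  · simp only [dualRel, not_forall] at hxy
    obtain ⟨U, hU, hy⟩ := hxy
    exact ⟨U, U.2, fun z hz => hz U hU, hy⟩
  · exact box_dualRel α ⟨U, hU⟩ ▸ (α ⟨U, hU⟩).2

end Adm

namespace IsPointedStone

variable {X Y : PGPSpace.{u}}

theorem mem_adm_iff (hX : IsPointedStone X) {U : Set X.carrier} :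
    U ∈ X.adm ↔ IsClopen U ∧ X.m ∈ U := by
  let : OrderTop X.carrier := { top := X.m, le_top := X.le_m }
  have hX₀ : X.X₀ = {X.m}ᶜ := hX.1
  have htriv (x y : X.carrier) (hxy : x ≤ y) : x = y ∨ y = X.m := by
    refine or_iff_not_imp_right.2 fun hy => hX.2 x ?_ y (hX₀ ▸ hy) hxy
    rw [hX₀]
    rintro rfl
    exact hy (top_le_iff.1 hxy)
  change Admissible X.X₀ U ↔ _
  rw [hX₀]
  exact admissible_compl_top_iff htriv

theorem mem_X₀_iff_exists_notMem (hX : IsPointedStone X) {x : X.carrier} :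
    x ∈ X.X₀ ↔ ∃ U : X.adm, x ∉ U.1 := by
  refine ⟨fun hx => ?_, fun ⟨U, hU⟩ => ?_⟩
  · obtain ⟨U, hU, hxU⟩ := ((X.mem_X₀_iff x).1 hx).1
    exact ⟨⟨U, hU⟩, hxU⟩
  · rw [show X.X₀ = {X.m}ᶜ from hX.1]
    rintro rfl
    exact hU (hX.mem_adm_iff.1 U.2).2

theorem union_mem_adm (hX : IsPointedStone X) {U V : Set X.carrier} (hU : U ∈ X.adm)
    (hV : V ∈ X.adm) : U ∪ V ∈ X.adm := by
  rw [hX.mem_adm_iff] at *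
  exact ⟨hU.1.union hV.1, .inl hU.2⟩

theorem union_compl_mem_adm (hX : IsPointedStone X) {U V : Set X.carrier} (hU : U ∈ X.adm)
    (hV : V ∈ X.adm) : U ∪ Vᶜ ∈ X.adm := by
  rw [hX.mem_adm_iff] at *
  exact ⟨hU.1.union hV.1.compl, .inl hU.2⟩

theorem forall_mem_X₀_iff (hX : IsPointedStone X) (hY : IsPointedStone Y) {f : StrongMor X Y} :
    (∀ x ∈ X.X₀, f.toHom x ∈ Y.X₀) ↔ ∀ W : X.adm, ∃ U : Y.adm, preimageHom f U ≤ W := by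
  refine ⟨fun hf W => ?_, fun hf x hx => ?_⟩
  · have hdir : Directed (· ⊇ ·) fun U : Y.adm => (preimageHom f U).1 := fun U V =>
      ⟨U ⊓ V, Set.inter_subset_left, Set.inter_subset_right⟩
    refine exists_subset_nhds_of_compactSpace hdir (fun U => (preimageHom f U).2.1.isClosed)
      (U := W.1) fun x hx => W.2.1.isOpen.mem_nhds ?_
    by_contra hxW
    obtain ⟨U, hU⟩ := hY.mem_X₀_iff_exists_notMem.1
      (hf x (hX.mem_X₀_iff_exists_notMem.2 ⟨W, hxW⟩))
    exact hU (Set.mem_iInter.1 hx U)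
  · obtain ⟨W, hW⟩ := hX.mem_X₀_iff_exists_notMem.1 hx
    obtain ⟨U, hU⟩ := hf W
    exact hY.mem_X₀_iff_exists_notMem.2 ⟨U, fun h => hW (hU h)⟩

end IsPointedStone

section PreimageHom

variable {X Y : PGPSpace.{u}} [Fact (IsPointedStone X)] [hY : Fact (IsPointedStone Y)]

instance : DistribLattice X.adm where
  __ := Subtype.lattice (fun _ _ => (Fact.out : IsPointedStone X).union_mem_adm)
    fun _ _ => PGPSpace.inter_mem_adm
  le_sup_inf U V W := le_sup_inf (x := U.1) (y := V.1) (z := W.1)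

theorem isGenBoolean_adm : IsGenBoolean (DMS.of X.adm) :=
  isGenBoolean_of fun A U hAU => by
    refine ⟨⟨A ∪ U.1ᶜ, (Fact.out : IsPointedStone X).union_compl_mem_adm A.2 U.2⟩,
      Subtype.ext ?_, Subtype.ext ?_⟩
    · change U.1 ∩ (A ∪ U.1ᶜ) = A
      rw [Set.inter_union_distrib_left, Set.inter_compl_self, Set.union_empty]
      exact Set.inter_eq_right.2 hAU
    · change U.1 ∪ (A ∪ U.1ᶜ) = Set.univ
      rw [Set.union_left_comm, Set.union_compl_self, Set.union_univ]

theorem isPMorphism_preimageHom_iff {f : StrongMor X Y} :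
    IsPMorphism (DMS.ofHom (preimageHom f)) ↔ ∀ x ∈ X.X₀, f.toHom x ∈ Y.X₀ := by
  rw [isPMorphism_ofHom_iff, (Fact.out : IsPointedStone X).forall_mem_X₀_iff hY.out]
  exact and_iff_right fun _ _ => rfl

theorem exists_mem_iff_mem_map {α : InfTopHom Y.adm X.adm}
    (hα : ∀ U V, α (U ⊔ V) = α U ⊔ α V) (x : X.carrier) :
    ∃ y : Y.carrier, ∀ U : Y.adm, y ∈ U.1 ↔ x ∈ (α U).1 := by
  by_cases htop : ∀ U, x ∈ (α U).1
  · exact ⟨Y.m, fun U => iff_of_true (hY.out.mem_adm_iff.1 U.2).2 (htop U)⟩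
  obtain ⟨U₀, hU₀⟩ := not_forall.1 htop
  rw [← box_dualRel] at hU₀
  obtain ⟨y, hxy, hyU₀⟩ : ∃ y, dualRel α x y ∧ y ∉ U₀.1 := by simpa [box] using hU₀
  refine ⟨y, fun U => ⟨fun hyU => ?_, hxy U⟩⟩
  let V : Y.adm := ⟨U₀ ∪ U.1ᶜ, hY.out.union_compl_mem_adm U₀.2 U.2⟩
  have hUV : U ⊔ V = ⊤ := Subtype.ext (by
    change U.1 ∪ (U₀ ∪ U.1ᶜ) = Set.univ
    rw [Set.union_left_comm, Set.union_compl_self, Set.union_univ])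
  have hx : x ∈ (α U).1 ∪ (α V).1 := by
    change x ∈ (α U ⊔ α V).1
    rw [← hα, hUV, map_top]
    trivial
  exact hx.resolve_right fun h => (hxy V h).elim hyU₀ fun h' => h' hyU

theorem exists_preimageHom_eq {α : InfTopHom Y.adm X.adm}
    (hα : ∀ U V, α (U ⊔ V) = α U ⊔ α V) : ∃ f : StrongMor X Y, preimageHom f = α := by
  choose f hf using exists_mem_iff_mem_map hα
  have hpre (U : Y.adm) : f ⁻¹' U.1 = (α U).1 := Set.ext fun x => hf x U
  have hmono : Monotone f := fun x x' hxx' => (Y.le_iff _ _).2 fun U hU hx =>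
    (hf x' ⟨U, hU⟩).2 ((α ⟨U, hU⟩).2.2.1 hxx' ((hf x ⟨U, hU⟩).1 hx))
  exact ⟨⟨⟨f, hmono⟩, fun U hU => hpre ⟨U, hU⟩ ▸ (α ⟨U, hU⟩).2⟩,
    InfTopHom.ext fun U => Subtype.ext (hpre U)⟩

end PreimageHom

section Functors

open Opposite

instance (X : PStone.{u}) : Fact (IsPointedStone X.obj.space) := ⟨X.property⟩

instance (X : PStoneS.{u}) : Fact (IsPointedStone X.obj.space) := ⟨X.property⟩

/-- Admissible clopen upsets, with the boxes of generalized Priestley morphisms. -/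
def boxFunctor : PStone.{u}ᵒᵖ ⥤ GBAM.{u} where
  obj X := ⟨DMS.of X.unop.obj.space.adm, isGenBoolean_adm⟩
  map R := ObjectProperty.homMk (DMS.ofHom (boxHom R.unop.hom))
  map_id _ := ObjectProperty.hom_ext _ <| DMS.hom_ext fun U => Subtype.ext (GPMor.box_id U.2)
  map_comp _ _ := ObjectProperty.hom_ext _ <| DMS.hom_ext fun U =>
    Subtype.ext (GPMor.box_comp _ _ U.2)

instance : boxFunctor.{u}.Faithful where
  map_injective h := Quiver.Hom.unop_inj <| ObjectProperty.hom_ext _ <|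
    boxHom_injective (congrArg (·.hom.hom) h)

instance : boxFunctor.{u}.Full where
  map_surjective {X Y} α := by
    obtain ⟨R, hR⟩ := boxHom_surjective α.hom.hom
    exact ⟨(ObjectProperty.homMk R : Y.unop ⟶ X.unop).op,
      ObjectProperty.hom_ext _ (ObjectProperty.hom_ext _ hR)⟩

/-- Admissible clopen upsets, with the preimages under strong Priestley morphisms. -/
def preimageFunctor : PStoneS.{u}ᵒᵖ ⥤ GBAM.{u} where
  obj X := ⟨DMS.of X.unop.obj.space.adm, isGenBoolean_adm⟩
  map f := ObjectProperty.homMk (DMS.ofHom (preimageHom f.unop.hom))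

instance : preimageFunctor.{u}.Faithful where
  map_injective h := Quiver.Hom.unop_inj <| ObjectProperty.hom_ext _ <|
    preimageHom_injective (congrArg (·.hom.hom) h)

theorem isSupMorphism_preimageFunctor_map {X Y : PStoneS.{u}ᵒᵖ} (f : X ⟶ Y) :
    IsSupMorphism (preimageFunctor.map f).hom :=
  isSupMorphism_ofHom_iff.2 fun _ _ => rfl

theorem exists_preimageFunctor_map_eq {X Y : PStoneS.{u}ᵒᵖ}
    (g : preimageFunctor.obj X ⟶ preimageFunctor.obj Y) (hg : IsSupMorphism g.hom) :
    ∃ f, preimageFunctor.map f = g := by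
  obtain ⟨f, hf⟩ := exists_preimageHom_eq (isSupMorphism_ofHom_iff.1 hg)
  exact ⟨(ObjectProperty.homMk f : Y.unop ⟶ X.unop).op,
    ObjectProperty.hom_ext _ (ObjectProperty.hom_ext _ hf)⟩

theorem isPMorphism_preimageFunctor_map_iff {X Y : PStoneS.{u}ᵒᵖ} {f : X ⟶ Y} :
    IsPMorphism (preimageFunctor.map f).hom ↔ MapsX₀ f.unop.hom :=
  isPMorphism_preimageHom_iff

end Functors

section PrimeSpectrum

/-- The lattice homomorphisms from `M` to the two-element lattice that preserve the top, as a closed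
subspace of `M → Bool`. The constant homomorphism is the greatest element; the other homomorphisms
correspond to the prime filters of `M`. -/
def Spectrum (M : Type u) [DistribLattice M] [OrderTop M] : Type u :=
  {p : M → Bool // p ⊤ = ⊤ ∧ (∀ a b, p (a ⊓ b) = p a ⊓ p b) ∧ ∀ a b, p (a ⊔ b) = p a ⊔ p b}

variable {M : Type u} [DistribLattice M] [OrderTop M]

instance : TopologicalSpace (Spectrum M) := inferInstanceAs (TopologicalSpace (Subtype _))

instance : PartialOrder (Spectrum M) := inferInstanceAs (PartialOrder (Subtype _))

instance : OrderTop (Spectrum M) where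
  top := ⟨⊤, rfl, fun _ _ => rfl, fun _ _ => rfl⟩
  le_top _ _ := le_top

instance : CompactSpace (Spectrum M) := by
  have htop : IsClosed {p : M → Bool | p ⊤ = ⊤} := isClosed_eq (continuous_apply _) continuous_const
  have hop (op : Bool → Bool → Bool) (f : M → M → M) :
      IsClosed {p : M → Bool | ∀ a b, p (f a b) = op (p a) (p b)} := by
    simp only [Set.ofPred_forall]
    exact isClosed_iInter fun a => isClosed_iInter fun b => isClosed_eq (continuous_apply _)
      ((continuous_of_discreteTopology (f := Function.uncurry op)).comp₂ (continuous_apply a)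
        (continuous_apply b))
  exact isCompact_iff_compactSpace.1 (htop.inter ((hop _ _).inter (hop _ _))).isCompact

namespace Spectrum

/-- The clopen upset of the points that contain `a`, when points are viewed as filters. -/
def basic (a : M) : Set (Spectrum M) := {p | p.1 a = true}

theorem mem_basic_inf {p : Spectrum M} {a b : M} :
    p ∈ basic (a ⊓ b) ↔ p ∈ basic a ∧ p ∈ basic b := by
  simp [basic, p.2.2.1]

theorem mem_basic_sup {p : Spectrum M} {a b : M} :
    p ∈ basic (a ⊔ b) ↔ p ∈ basic a ∨ p ∈ basic b := by
  simp [basic, p.2.2.2]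

theorem mem_basic_top (p : Spectrum M) : p ∈ basic (⊤ : M) := p.2.1

theorem top_mem_basic (a : M) : ⊤ ∈ basic a := rfl

theorem isClopen_basic (a : M) : IsClopen (basic a) :=
  (isClopen_discrete {true}).preimage ((continuous_apply a).comp continuous_subtype_val)

theorem le_iff_basic {p q : Spectrum M} : p ≤ q ↔ ∀ a, p ∈ basic a → q ∈ basic a :=
  Iff.rfl

theorem eq_top_of_forall_mem_basic {p : Spectrum M} (h : ∀ a, p ∈ basic a) : p = ⊤ :=
  Subtype.ext (funext h)

instance : PriestleySpace (Spectrum M) where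
  priestley {p q} h := by
    obtain ⟨a, hp, hq⟩ : ∃ a, p ∈ basic a ∧ q ∉ basic a := by simpa [le_iff_basic] using h
    exact ⟨basic a, isClopen_basic a, fun p q hpq => le_iff_basic.1 hpq a, hp, hq⟩

theorem exists_mem_notMem_basic {a b : M} (h : ¬ a ≤ b) : ∃ p, p ∈ basic a ∧ p ∉ basic b := by
  classical
  obtain ⟨J, hJ, hbJ, hd⟩ := DistribLattice.prime_ideal_of_disjoint_filter_ideal
    (F := Order.PFilter.principal a) (I := Order.Ideal.principal b)
    (Set.disjoint_left.2 fun c hac hcb => h (le_trans (Order.PFilter.mem_principal.1 hac) hcb))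
  have haJ : a ∉ J := Set.disjoint_left.1 hd (Order.PFilter.mem_principal.2 le_rfl)
  have hinf (c d : M) : c ⊓ d ∈ J ↔ c ∈ J ∨ d ∈ J :=
    ⟨hJ.mem_or_mem, fun h => h.elim (J.lower inf_le_left) (J.lower inf_le_right)⟩
  refine ⟨⟨fun c => decide (c ∉ J), decide_eq_true fun h => haJ (J.lower le_top h),
    fun c d => by simp [hinf], fun c d => by simp [Order.Ideal.sup_mem_iff]⟩,
    decide_eq_true haJ, fun h => of_decide_eq_true h (hbJ (Order.Ideal.mem_principal.2 le_rfl))⟩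

theorem basic_subset_iff {a b : M} : basic a ⊆ basic b ↔ a ≤ b := by
  refine ⟨fun h => ?_, fun h p hp => ?_⟩
  · by_contra hab
    obtain ⟨p, hp, hq⟩ := exists_mem_notMem_basic hab
    exact hq (h hp)
  · rw [← sup_eq_right.2 h, mem_basic_sup]
    exact .inl hp

theorem eq_or_eq_top_of_le (hM : ∀ a x : M, a ≤ x → ∃ y, x ⊓ y = a ∧ x ⊔ y = ⊤) {p q : Spectrum M}
    (hpq : p ≤ q) : p = q ∨ q = ⊤ := by
  refine or_iff_not_imp_right.2 fun hq => hpq.antisymm (le_iff_basic.2 fun a hqa => ?_)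
  obtain ⟨b, hqb⟩ := not_forall.1 (mt eq_top_of_forall_mem_basic hq)
  obtain ⟨y, hinf, hsup⟩ := hM (a ⊓ b) a inf_le_left
  have hqy : q ∉ basic y := fun hqy =>
    hqb (mem_basic_inf.1 (hinf ▸ mem_basic_inf.2 ⟨hqa, hqy⟩)).2
  exact (mem_basic_sup.1 (hsup ▸ mem_basic_top p)).resolve_right (mt (le_iff_basic.1 hpq y) hqy)

variable {U : Set (Spectrum M)}

theorem exists_subset_basic_notMem (hU : IsClopen U) (hup : IsUpperSet U) (htop : ⊤ ∈ U)
    {p : Spectrum M} (hp : p ∉ U) : ∃ a : M, U ⊆ basic a ∧ p ∉ basic a := by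
  let F : Set M := {a | p ∉ basic a}
  have hdir : Directed (· ⊇ ·) fun a : F => (basic a.1)ᶜ := fun a b =>
    ⟨⟨a.1 ⊔ b.1, mt mem_basic_sup.1 (not_or.2 ⟨a.2, b.2⟩)⟩,
      Set.compl_subset_compl.2 (basic_subset_iff.2 le_sup_left),
      Set.compl_subset_compl.2 (basic_subset_iff.2 le_sup_right)⟩
  have hp_top : p ≠ ⊤ := fun h => hp (h ▸ htop)
  obtain ⟨a₀, ha₀⟩ := not_forall.1 (mt eq_top_of_forall_mem_basic hp_top)
  have : Nonempty F := ⟨⟨a₀, ha₀⟩⟩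
  obtain ⟨a, ha⟩ := exists_subset_nhds_of_compactSpace hdir
    (fun a => (isClopen_basic a.1).compl.isClosed) (U := Uᶜ) fun q hq => by
      refine hU.compl.isOpen.mem_nhds fun hqU => hp (hup (le_iff_basic.2 fun a hqa => ?_) hqU)
      by_contra hpa
      exact Set.mem_iInter.1 hq ⟨a, hpa⟩ hqa
  exact ⟨a.1, Set.compl_subset_compl.1 ha, a.2⟩

theorem exists_basic_eq (hU : IsClopen U) (hup : IsUpperSet U) (htop : ⊤ ∈ U) :
    ∃ a : M, basic a = U := by
  let F : Set M := {a | U ⊆ basic a}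
  have hdir : Directed (· ⊇ ·) fun a : F => basic a.1 := fun a b =>
    ⟨⟨a.1 ⊓ b.1, fun p hp => mem_basic_inf.2 ⟨a.2 hp, b.2 hp⟩⟩,
      basic_subset_iff.2 inf_le_left, basic_subset_iff.2 inf_le_right⟩
  have : Nonempty F := ⟨⟨⊤, fun p _ => mem_basic_top p⟩⟩
  obtain ⟨a, ha⟩ := exists_subset_nhds_of_compactSpace hdir (fun a => (isClopen_basic a.1).isClosed)
    (U := U) fun p hp => hU.isOpen.mem_nhds (by
      by_contra hpU
      obtain ⟨a, hUa, hpa⟩ := exists_subset_basic_notMem hU hup htop hpU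
      exact hpa (Set.mem_iInter.1 hp ⟨a, hUa⟩))
  exact ⟨a.1, ha.antisymm a.2⟩

/-- The isomorphism from `M` onto the admissible clopen upsets of its spectrum. -/
noncomputable def orderIsoAdm (hM : ∀ a x : M, a ≤ x → ∃ y, x ⊓ y = a ∧ x ⊔ y = ⊤) :
    M ≃o (PGPSpace.ofOrderTop fun _ _ : Spectrum M => eq_or_eq_top_of_le hM).adm :=
  RelIso.ofSurjective
    (OrderEmbedding.ofMapLEIff
      (fun a => ⟨basic a, (admissible_compl_top_iff fun _ _ => eq_or_eq_top_of_le hM).2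
        ⟨isClopen_basic a, top_mem_basic a⟩⟩)
      fun _ _ => basic_subset_iff)
    fun ⟨U, hU⟩ => by
      obtain ⟨a, ha⟩ := exists_basic_eq hU.1 hU.2.1
        ((admissible_compl_top_iff fun _ _ => eq_or_eq_top_of_le hM).1 hU).2
      exact ⟨a, Subtype.ext ha⟩

end Spectrum

end PrimeSpectrum

/-- The distributive lattice underlying a generalized Boolean algebra. -/
noncomputable abbrev IsGenBoolean.distribLattice {M : DMS.{u}} (hM : IsGenBoolean M) :
    DistribLattice M.obj :=
  let L : Lattice M.obj :=
    { (inferInstance : SemilatticeInf M.obj) with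
      sup a b := (hM.1 a b).choose
      le_sup_left a b := (hM.1 a b).choose_spec.1 (Set.mem_insert _ _)
      le_sup_right a b := (hM.1 a b).choose_spec.1 (Set.mem_insert_of_mem _ rfl)
      sup_le a b c ha hb := (hM.1 a b).choose_spec.2 (by simp [ha, hb]) }
  { L with
    le_sup_inf x y z := by
      obtain ⟨y', z', hy, hz, hyz⟩ := M.property y z (x ⊔ y ⊓ z) le_sup_right
      obtain ⟨hxy, hxz⟩ : x ≤ y' ∧ x ≤ z' := le_inf_iff.1 (hyz ▸ le_sup_left)
      exact hyz ▸ inf_le_inf (sup_le hxy hy) (sup_le hxz hz) }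

theorem IsGenBoolean.exists_orderIso_adm {M : DMS.{u}} (hM : IsGenBoolean M) :
    ∃ X : PGPSpace.{u}, IsPointedStone X ∧ Nonempty (M.obj ≃o X.adm) := by
  let : DistribLattice M.obj := hM.distribLattice
  let : OrderTop M.obj := M.obj.isOrderTop
  have hcompl (a x : M.obj) (hax : a ≤ x) : ∃ y, x ⊓ y = a ∧ x ⊔ y = ⊤ := by
    obtain ⟨y, -, hinf, hsup⟩ := hM.2 a x hax
    exact ⟨y, hinf, isLUB_pair.unique hsup⟩
  exact ⟨_, isPointedStone_ofOrderTop fun _ _ => Spectrum.eq_or_eq_top_of_le hcompl,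
    ⟨Spectrum.orderIsoAdm hcompl⟩⟩

section OpenFrame

open TopologicalSpace

/-- The algebraic frame of open subsets of a space with a basis of compact open sets. -/
def openFrame (Y : Type u) [TopologicalSpace Y] [PrespectralSpace Y] : AlgFrmJ.{u} where
  carrier := Opens Y
  algebraic := ⟨fun U => by
    obtain ⟨B, hB, rfl⟩ := Opens.isBasis_iff_cover.1 (PrespectralSpace.isBasis_opens Y) U
    exact ⟨B, fun K hK => (Opens.isCompactElement_iff K).2 (hB hK), rfl⟩⟩

theorem isZeroDimensional_openFrame (Y : Type u) [TopologicalSpace Y] [PrespectralSpace Y]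
    [T2Space Y] : IsZeroDimensional (openFrame Y) := fun U => by
  obtain ⟨B, hB, hU⟩ := Opens.isBasis_iff_cover.1 (PrespectralSpace.isBasis_opens Y) U
  refine ⟨B, fun (K : Opens Y) hK => ⟨⟨(K : Set Y)ᶜ, (hB hK).isClosed.isOpen_compl⟩, ?_⟩, hU.symm⟩
  exact .of_eq (Opens.ext (Set.inter_compl_self _)) (Opens.ext (Set.union_compl_self _))

variable {X : PGPSpace.{u}}

theorem IsPointedStone.isOpenEmbedding_val (hX : IsPointedStone X) :
    IsOpenEmbedding (Subtype.val : X.X₀ → X.carrier) := by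
  rw [show X.X₀ = {X.m}ᶜ from hX.1]
  exact isClosed_singleton.isOpen_compl.isOpenEmbedding_subtypeVal

theorem IsPointedStone.prespectralSpace_X₀ (hX : IsPointedStone X) : PrespectralSpace X.X₀ :=
  have : PrespectralSpace X.carrier :=
    .of_isTopologicalBasis isTopologicalBasis_isClopen fun _ hU => hU.1.isCompact
  hX.isOpenEmbedding_val.prespectralSpace

theorem IsPointedStone.compl_subset_X₀ (hX : IsPointedStone X) (U : X.adm) : U.1ᶜ ⊆ X.X₀ :=
  fun _ hx => hX.mem_X₀_iff_exists_notMem.2 ⟨U, hx⟩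

/-- The trace on `X₀` of the complement of an admissible clopen upset. -/
def complOpens (U : X.adm) : Opens X.X₀ :=
  ⟨Subtype.val ⁻¹' U.1ᶜ, U.2.1.compl.isOpen.preimage continuous_subtype_val⟩

theorem IsPointedStone.isCompactElement_complOpens (hX : IsPointedStone X) (U : X.adm) :
    IsCompactElement (complOpens U) :=
  (Opens.isCompactElement_iff _).2 <| hX.isOpenEmbedding_val.isInducing.isCompact_preimage'
    U.2.1.compl.isClosed.isCompact ((hX.compl_subset_X₀ U).trans_eq Subtype.range_val.symm)

theorem IsPointedStone.exists_complOpens_eq (hX : IsPointedStone X) {K : Opens X.X₀}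
    (hK : IsCompactElement K) : ∃ U : X.adm, complOpens U = K := by
  have hclopen : IsClopen (Subtype.val '' (K : Set X.X₀)) :=
    ⟨(((Opens.isCompactElement_iff K).1 hK).image continuous_subtype_val).isClosed,
      hX.isOpenEmbedding_val.isOpenMap _ K.2⟩
  have hm : X.m ∉ Subtype.val '' (K : Set X.X₀) := fun ⟨y, _, hy⟩ => X.m_notMem (hy ▸ y.2)
  refine ⟨⟨_, hX.mem_adm_iff.2 ⟨hclopen.compl, hm⟩⟩, Opens.ext ?_⟩
  change Subtype.val ⁻¹' (Subtype.val '' (K : Set X.X₀))ᶜᶜ = _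
  rw [compl_compl, Set.preimage_image_eq _ Subtype.val_injective]

theorem IsPointedStone.complOpens_le_complOpens_iff (hX : IsPointedStone X) {U V : X.adm} :
    complOpens V ≤ complOpens U ↔ U ≤ V := by
  refine ⟨fun h => Set.compl_subset_compl.1 fun x hx => ?_, fun h x hx hxU => hx (h hxU)⟩
  exact @h ⟨x, hX.compl_subset_X₀ V hx⟩ hx

/-- The order-reversing isomorphism from the admissible clopen upsets of a pointed Stone space onto
the compact open subsets of `X₀`. -/
noncomputable def admOrderIso (hX : IsPointedStone X) :
    X.adm ≃o (CompactElement (Opens X.X₀))ᵒᵈ :=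
  RelIso.ofSurjective
    (OrderEmbedding.ofMapLEIff
      (fun U => toDual (⟨complOpens U, hX.isCompactElement_complOpens U⟩ : CompactElement _))
      fun _ _ => hX.complOpens_le_complOpens_iff)
    fun K => (hX.exists_complOpens_eq (ofDual K).2).imp fun _ h => Subtype.ext h

end OpenFrame

section Equivalences

open Opposite

/-- An order isomorphism between generalized Boolean algebras, as an isomorphism of `GBAM`. -/
def GBAM.isoMk {M N : GBAM.{u}} (e : M.obj.obj ≃o N.obj.obj) : M ≅ N :=
  ObjectProperty.isoMk _ (ObjectProperty.isoMk _ (SemilatInfCat.Iso.mk e))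

instance : boxFunctor.{u}.EssSurj where
  mem_essImage M := by
    obtain ⟨X, hX, ⟨e⟩⟩ := M.property.exists_orderIso_adm
    exact ⟨op ⟨⟨X⟩, hX⟩, ⟨GBAM.isoMk e.symm⟩⟩

instance : preimageFunctor.{u}.EssSurj where
  mem_essImage M := by
    obtain ⟨X, hX, ⟨e⟩⟩ := M.property.exists_orderIso_adm
    exact ⟨op ⟨⟨X⟩, hX⟩, ⟨GBAM.isoMk e.symm⟩⟩

instance : compactFunctor.{u}.EssSurj where
  mem_essImage M := by
    obtain ⟨X, hX, ⟨e⟩⟩ := M.property.exists_orderIso_adm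
    have := hX.prespectralSpace_X₀
    exact ⟨⟨openFrame X.X₀, isZeroDimensional_openFrame X.X₀⟩,
      ⟨GBAM.isoMk (e.trans (admOrderIso hX)).symm⟩⟩

instance : compactFunctor.{u}.IsEquivalence where

instance : boxFunctor.{u}.IsEquivalence where

theorem isSupMorphism_forgetWide_comp_compactFunctor_map {L N : GStoneFrmS.{u}} (f : L ⟶ N) :
    IsSupMorphism ((forgetWide _ _ ⋙ compactFunctor).map f).hom :=
  (isSupMorphism_compactFunctor_map_iff (f := (forgetWide _ _).map f)).2 f.hom.property

/-- The restriction of `compactFunctor` to frames with morphisms preserving compact meets. -/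
def compactFunctorS : GStoneFrmS.{u} ⥤ GBA.{u} :=
  liftWide _ isSupMorphism_forgetWide_comp_compactFunctor_map

theorem isPMorphism_forgetWide_comp_compactFunctor_map {L N : GStoneFrm.{u}} (f : L ⟶ N) :
    IsPMorphism ((forgetWide _ _ ⋙ compactFunctor).map f).hom :=
  (isPMorphism_compactFunctor_map_iff (f := (forgetWide _ _).map f)).2 f.hom.property

/-- The restriction of `compactFunctor` to frame homomorphisms. -/
def compactFunctorP : GStoneFrm.{u} ⥤ GBAP.{u} :=
  liftWide _ isPMorphism_forgetWide_comp_compactFunctor_map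

/-- `preimageFunctor`, with values in generalized Boolean algebras and lattice homomorphisms. -/
def preimageFunctorS : PStoneS.{u}ᵒᵖ ⥤ GBA.{u} :=
  liftWide preimageFunctor isSupMorphism_preimageFunctor_map

theorem isPMorphism_forgetWide_op_comp_preimageFunctor_map {X Y : PStoneP.{u}ᵒᵖ} (f : X ⟶ Y) :
    IsPMorphism (((forgetWide _ _).op ⋙ preimageFunctor).map f).hom :=
  isPMorphism_preimageFunctor_map_iff.2 f.unop.hom.property

/-- The restriction of `preimageFunctor` to the morphisms that preserve `X₀`. -/
def preimageFunctorP : PStoneP.{u}ᵒᵖ ⥤ GBAP.{u} :=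
  liftWide _ isPMorphism_forgetWide_op_comp_preimageFunctor_map

instance : compactFunctorS.{u}.IsEquivalence :=
  isEquivalence_liftWide _
    (fun g hg => by
      obtain ⟨f, rfl⟩ := compactFunctor.map_surjective g
      obtain ⟨f, rfl⟩ := exists_forgetWide_map_eq f (isSupMorphism_compactFunctor_map_iff.1 hg)
      exact ⟨f, rfl⟩)
    (isomorphisms_le_isPMorphism.trans isPMorphism_le_isSupMorphism)

instance : compactFunctorP.{u}.IsEquivalence :=
  isEquivalence_liftWide _
    (fun g hg => by
      obtain ⟨f, rfl⟩ := compactFunctor.map_surjective g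
      obtain ⟨f, rfl⟩ := exists_forgetWide_map_eq f (isPMorphism_compactFunctor_map_iff.1 hg)
      exact ⟨f, rfl⟩)
    isomorphisms_le_isPMorphism

instance : preimageFunctorS.{u}.IsEquivalence :=
  isEquivalence_liftWide _ exists_preimageFunctor_map_eq
    (isomorphisms_le_isPMorphism.trans isPMorphism_le_isSupMorphism)

instance : preimageFunctorP.{u}.IsEquivalence :=
  isEquivalence_liftWide _
    (fun g hg => by
      obtain ⟨f, rfl⟩ := exists_preimageFunctor_map_eq g (isPMorphism_le_isSupMorphism _ hg)
      obtain ⟨f, hf⟩ :=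
        exists_forgetWide_map_eq f.unop (isPMorphism_preimageFunctor_map_iff.1 hg)
      exact ⟨f.op, congrArg (fun f => preimageFunctor.map (Quiver.Hom.op f)) hf⟩)
    isomorphisms_le_isPMorphism

end Equivalences

end PointedStone

theorem mainTheorem12 :
    (Nonempty (GStoneFrmJ.{u} ≌ GBAM.{u}) ∧ Nonempty (GStoneFrmJ.{u} ≌ PStone.{u}ᵒᵖ)) ∧
    (Nonempty (GStoneFrmS.{u} ≌ GBA.{u}) ∧ Nonempty (GStoneFrmS.{u} ≌ PStoneS.{u}ᵒᵖ)) ∧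
    (Nonempty (GStoneFrm.{u} ≌ GBAP.{u}) ∧ Nonempty (GStoneFrm.{u} ≌ PStoneP.{u}ᵒᵖ)) := by
  let eJ : GStoneFrmJ.{u} ≌ GBAM.{u} := compactFunctor.asEquivalence
  let eS : GStoneFrmS.{u} ≌ GBA.{u} := compactFunctorS.asEquivalence
  let eP : GStoneFrm.{u} ≌ GBAP.{u} := compactFunctorP.asEquivalence
  exact ⟨⟨⟨eJ⟩, ⟨eJ.trans boxFunctor.asEquivalence.symm⟩⟩,
    ⟨⟨eS⟩, ⟨eS.trans preimageFunctorS.asEquivalence.symm⟩⟩,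
    ⟨⟨eP⟩, ⟨eP.trans preimageFunctorP.asEquivalence.symm⟩⟩⟩
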